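/- Let $n\ge 0$, let $S_n$ be the symmetric group on $\{1,\dots,n\}$, with length function $\ell$ (number of inversions) and Bruhat order $\le$. Put $\mathbf{S}=\{0,\dots,n\}^2$, and for $w\in S_n$ and $(i,j)\in \mathbf{S}$ let $$r_w(i,j)=\#\{1\le u\le i: w(u)\le j\}.$$ For $p=(i,j)$ and $p'=(i',j')$ in $\mathbf{S}$ write $\operatorname{cor}(p,p')=\{(i,j'),(i',j)\}$, $$\Delta_w(p,p')=r_w(i,j)+r_w(i',j')-r_w(i,j')-r_w(i',j),$$ and $p\bowtie p'$ if $(i'-i)(j'-j)>0$. For $A,B\subseteq \mathbf{S}$ let $$C_A^w(B)=B\cup\{p\in \mathbf{S}:\exists\,p'\in A,\ p\bowtie p',\ \Delta_w(p,p')=0,\ \operatorname{cor}(p,p')\subseteq B\},$$ and define the influence set of $A$ as $\operatorname{Infl}^w(A)=\bigcup_{k\ge 0}A_k$, where $A_0=A$ and $A_k=C_A^w(A_{k-1})$ for $k>0$. Let $w,x\in S_n$ with $x\le w$, and suppose that the pair $\pi=(w,x)$ is smooth, i.e. the number of transpositions $t\in S_n$ with $x<xt\le w$ equals $\ell(w)-\ell(x)$.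 Let $X_\pi=\{p\in \mathbf{S}: r_x(p)=r_w(p)\}$. Then $\pi$ is influential, i.e. $$\operatorname{Infl}^w(X_\pi)=\mathbf{S}.$$ Consequently $\pi$ is tight: every $y\in S_n$ such that $r_y(p)=r_w(p)$ for all $p\in X_\pi$ satisfies $y\le w$. -/

import Mathlib

namespace SchubertPairs

open Equiv

/-- The length of a permutation of `{1, …, n}` (modelled on `Fin n`): its number of inversions. -/
def len {n : ℕ} (w : Perm (Fin n)) : ℕ :=
  (Finset.univ.filter fun p : Fin n × Fin n => p.1 < p.2 ∧ w p.2 < w p.1).card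

/-- The Bruhat order `x ≤ w` on the symmetric group: the reflexive transitive closure of the
relations `u → u t` with `t` a transposition and `ℓ (u t) > ℓ u`. -/
def BruhatLE {n : ℕ} (x w : Perm (Fin n)) : Prop :=
  Relation.ReflTransGen
    (fun u v : Perm (Fin n) => ∃ t : Perm (Fin n), t.IsSwap ∧ v = u * t ∧ len u < len v) x w

/-- The strict Bruhat order. -/
def BruhatLT {n : ℕ} (x w : Perm (Fin n)) : Prop :=
  BruhatLE x w ∧ x ≠ w

/-- The framed square `{0, …, n} × {0, …, n}`. -/
abbrev FramedSquare (n : ℕ) : Type := Fin (n + 1) × Fin (n + 1)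

/-- The rank function `rk_w (i, j) = #{u = 1, …, i : w u ≤ j}`. An element `u` of `{1, …, n}` is
represented by the element of `Fin n` with value `u - 1`, so that `u ≤ i` becomes `↑u < ↑i` and
`w u ≤ j` becomes `↑(w u) < ↑j`. -/
def rk {n : ℕ} (w : Perm (Fin n)) (p : FramedSquare n) : ℕ :=
  (Finset.univ.filter fun u : Fin n => (u : ℕ) < (p.1 : ℕ) ∧ (w u : ℕ) < (p.2 : ℕ)).card

/-- The two other corners `(i, j'), (i', j)` of the rectangle spanned by `(i, j)` and `(i', j')`. -/
def corners {n : ℕ} (p p' : FramedSquare n) : Set (FramedSquare n) :=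
  {(p.1, p'.2), (p'.1, p.2)}

/-- The difference function
`rk_w (i, j) + rk_w (i', j') - rk_w (i, j') - rk_w (i', j)`. -/
def diff {n : ℕ} (w : Perm (Fin n)) (p p' : FramedSquare n) : ℤ :=
  ((rk w p : ℤ) + rk w p') - ((rk w (p.1, p'.2) : ℤ) + rk w (p'.1, p.2))

/-- `p` and `p'` are comparable in the strict sense: one of them is strictly smaller than the
other in both coordinates. -/
def StrictCmp {n : ℕ} (p p' : FramedSquare n) : Prop :=
  (p.1 < p'.1 ∧ p.2 < p'.2) ∨ (p'.1 < p.1 ∧ p'.2 < p.2)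

/-- The set of transpositions `t` with `x < x t ≤ w`. -/
def reflections {n : ℕ} (w x : Perm (Fin n)) : Set (Perm (Fin n)) :=
  {t | t.IsSwap ∧ BruhatLT x (x * t) ∧ BruhatLE (x * t) w}

/-- `(w, x)` is a smooth pair: `x ≤ w`, and the number of transpositions `t` with `x < x t ≤ w`
equals `ℓ w - ℓ x`. -/
def IsSmoothPair {n : ℕ} (w x : Perm (Fin n)) : Prop :=
  BruhatLE x w ∧ ((reflections w x).ncard : ℤ) = (len w : ℤ) - (len x : ℤ)

/-- The rank function `rk_x - rk_w` of the pair `(w, x)`. -/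
def pairRk {n : ℕ} (w x : Perm (Fin n)) (p : FramedSquare n) : ℤ :=
  (rk x p : ℤ) - (rk w p : ℤ)

/-- The level set of the pair `(w, x)`. -/
def levelSet {n : ℕ} (w x : Perm (Fin n)) : Set (FramedSquare n) :=
  {p | pairRk w x p = 0}

/-- The operator `C_A^w`. -/
def closureStep {n : ℕ} (w : Perm (Fin n)) (A B : Set (FramedSquare n)) :
    Set (FramedSquare n) :=
  B ∪ {p | ∃ p' ∈ A, StrictCmp p p' ∧ diff w p p' = 0 ∧ corners p p' ⊆ B}

/-- The sets `A_0 = A`, `A_k = C_A^w (A_{k-1})`. -/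
def inflStep {n : ℕ} (w : Perm (Fin n)) (A : Set (FramedSquare n)) : ℕ → Set (FramedSquare n)
  | 0 => A
  | k + 1 => closureStep w A (inflStep w A k)

/-- The influence set of `A` with respect to `w`: the union of the sets `A_k`. -/
def influenceSet {n : ℕ} (w : Perm (Fin n)) (A : Set (FramedSquare n)) : Set (FramedSquare n) :=
  ⋃ k : ℕ, inflStep w A k

/-- The pair `(w, x)` is influential: the influence set of its level set is the framed square. -/
def IsInfluential {n : ℕ} (w x : Perm (Fin n)) : Prop :=
  influenceSet w (levelSet w x) = Set.univ

/-- `A` is tight with respect to `w`: every `y` whose rank function agrees with that of `w`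
on `A` satisfies `y ≤ w`. -/
def IsTight {n : ℕ} (w : Perm (Fin n)) (A : Set (FramedSquare n)) : Prop :=
  ∀ y : Perm (Fin n), (∀ p ∈ A, rk y p = rk w p) → BruhatLE y w

end SchubertPairs

namespace SchubertPairs

open Equiv Finset

variable {n : ℕ}

/-! Bruhat order is dominance of rank functions (`BruhatLE.rankLE`, `RankLE.bruhatLE`). Write D for
the rank function of x minus that of w. It is nonnegative when x ≤ w, and the level set is its zero
set.

Smoothness enters through counting. `hit A y` counts the ascent pairs of y whose rectangle meets A.
By a Deodhar-type argument it cannot decrease along Bruhat steps that leave the ranks on A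
unchanged. Ascent pairs of x whose rectangle misses the level set give transpositions t with x < xt
≤ w, so smoothness makes all the inequalities in the chain between x and w tight. The result is
`IsSmoothPair.meets`: for x ≤ y ≤ w, an ascent rectangle of y containing a point where y and w have
equal rank also contains a zero of D.

If the influence set is not everything, this is contradicted. Among the missing points,
`exists_unblocked_pair` finds two that span a zero-free rectangle and see no zero of D beyond its
two extreme corners. The lemmas `exists_southwest_star` and `exists_northeast_star` then lower w,
staying above x, to a permutation z that has these corners as an ascent pair and still has the ranks
of w at the lower corner. Its rectangle violates `IsSmoothPair.meets`.

Tightness follows because each closure step propagates the inequality between the ranks of w and y.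
-/

/-! ### Rank functions, empty boxes and length. -/

/-- The rank function with integer values and natural number arguments. -/
def rank (w : Perm (Fin n)) (i j : ℕ) : ℤ :=
  ∑ u : Fin n, if (u : ℕ) < i ∧ (w u : ℕ) < j then 1 else 0

theorem rk_eq_rank (w : Perm (Fin n)) (p : FramedSquare n) :
    (rk w p : ℤ) = rank w p.1 p.2 := by
  simp [rk, rank]

theorem rank_zero_left (w : Perm (Fin n)) (j : ℕ) : rank w 0 j = 0 := by
  simp [rank]

theorem rank_zero_right (w : Perm (Fin n)) (i : ℕ) : rank w i 0 = 0 := by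
  simp [rank]

theorem rank_full_left (w : Perm (Fin n)) (j : ℕ) :
    rank w n j = ∑ u : Fin n, if (u : ℕ) < j then 1 else 0 := by
  simp only [rank, Fin.is_lt, true_and]
  exact Equiv.sum_comp w (fun u : Fin n => if (u : ℕ) < j then (1 : ℤ) else 0)

theorem rank_full_right (w : Perm (Fin n)) (i : ℕ) :
    rank w i n = ∑ u : Fin n, if (u : ℕ) < i then 1 else 0 := by
  simp only [rank, Fin.is_lt, and_true]

/-- Splitting a sum over `Fin n` at two distinct indices. -/
theorem sum_split_pair {M : Type*} [AddCommMonoid M] {a b : Fin n} (hab : a ≠ b) (g : Fin n → M) :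
    ∑ u, g u = g a + g b + ∑ u ∈ univ \ {a, b}, g u := by
  rw [← Finset.sum_sdiff (Finset.subset_univ ({a, b} : Finset (Fin n))), add_comm,
    Finset.sum_pair hab]

theorem mul_swap_of_notMem (y : Perm (Fin n)) {a b u : Fin n} (hu : u ∈ univ \ ({a, b} : Finset _)) :
    (y * swap a b) u = y u := by
  simp only [mem_sdiff, mem_univ, mem_insert, mem_singleton, true_and, not_or] at hu
  simp [swap_apply_of_ne_of_ne hu.1 hu.2]

/-- Only the terms at `a` and `b` change. The lattice points where the rank drops form exactly the
rectangle later tested by `Meets`. -/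
theorem rank_mul_swap (y : Perm (Fin n)) {a b : Fin n} (hab : a < b) (hy : y a < y b) (i j : ℕ) :
    rank (y * swap a b) i j =
      rank y i j - if (a : ℕ) < i ∧ i ≤ b ∧ (y a : ℕ) < j ∧ j ≤ y b then 1 else 0 := by
  unfold rank
  rw [sum_split_pair hab.ne, sum_split_pair hab.ne (fun u => if (u : ℕ) < i ∧ (y u : ℕ) < j
    then (1 : ℤ) else 0)]
  rw [Finset.sum_congr rfl (fun u hu => by rw [mul_swap_of_notMem y hu])]
  simp only [Perm.mul_apply, swap_apply_left, swap_apply_right]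
  have h1 : (a : ℕ) < b := hab
  have h2 : (y a : ℕ) < y b := hy
  split_ifs <;> omega

/-- No point of the graph of `w` lies in the half-open box between the lattice points
`(s, t)` and `(i, j)`. -/
def Free (w : Perm (Fin n)) (s i t j : ℕ) : Prop :=
  ∀ u : Fin n, s ≤ u → (u : ℕ) < i → t ≤ w u → ¬ (w u : ℕ) < j

theorem Free.mono {w : Perm (Fin n)} {s i t j s' i' t' j' : ℕ} (h : Free w s i t j)
    (hs : s ≤ s') (hi : i' ≤ i) (ht : t ≤ t') (hj : j' ≤ j) : Free w s' i' t' j' :=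
  fun u h1 h2 h3 h4 => h u (by omega) (by omega) (by omega) (by omega)

theorem rank_box (w : Perm (Fin n)) {s i t j : ℕ} (hs : s ≤ i) (ht : t ≤ j) :
    rank w i j + rank w s t - rank w s j - rank w i t =
      ∑ u : Fin n, if s ≤ u ∧ (u : ℕ) < i ∧ t ≤ w u ∧ (w u : ℕ) < j then 1 else 0 := by
  unfold rank
  rw [← sum_add_distrib, ← sum_sub_distrib, ← sum_sub_distrib]
  refine sum_congr rfl fun u _ => ?_
  split_ifs <;> omega

theorem rank_box_nonneg (w : Perm (Fin n)) {s i t j : ℕ} (hs : s ≤ i) (ht : t ≤ j) :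
    0 ≤ rank w i j + rank w s t - rank w s j - rank w i t := by
  rw [rank_box w hs ht]
  exact sum_nonneg fun u _ => by split_ifs <;> simp

theorem free_iff (w : Perm (Fin n)) {s i t j : ℕ} (hs : s ≤ i) (ht : t ≤ j) :
    Free w s i t j ↔ rank w i j + rank w s t = rank w s j + rank w i t := by
  have h := rank_box w hs ht
  have h' : rank w i j + rank w s t = rank w s j + rank w i t ↔
      rank w i j + rank w s t - rank w s j - rank w i t = 0 := by constructor <;> intro <;> linarith
  rw [h', h, sum_eq_zero_iff_of_nonneg (fun u _ => by split_ifs <;> simp)]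
  simp [Free]

theorem len_eq_sum (w : Perm (Fin n)) :
    len w = ∑ u : Fin n, ∑ v : Fin n, if u < v ∧ w v < w u then 1 else 0 := by
  rw [len, card_filter, ← univ_product_univ, sum_product]

/-- Comparison of two double sums whose terms agree off `{a, b}`. -/
theorem double_sum_le {a b : Fin n} (hab : a ≠ b) (F G : Fin n → Fin n → ℕ)
    (h0 : ∀ u v, u ≠ a → u ≠ b → v ≠ a → v ≠ b → F u v ≤ G u v)
    (h1 : ∀ c, c ≠ a → c ≠ b → F a c + F b c + (F c a + F c b) ≤ G a c + G b c + (G c a + G c b)) :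
    (∑ u, ∑ v, F u v) + (G a a + G a b + (G b a + G b b)) ≤
      (∑ u, ∑ v, G u v) + (F a a + F a b + (F b a + F b b)) := by
  have key : ∀ H : Fin n → Fin n → ℕ, ∑ u, ∑ v, H u v =
      (H a a + H a b + (H b a + H b b)) +
        ∑ c ∈ univ \ {a, b}, (H a c + H b c + (H c a + H c b)) +
        ∑ u ∈ univ \ {a, b}, ∑ v ∈ univ \ {a, b}, H u v := by
    intro H
    simp only [sum_split_pair hab, sum_add_distrib]
    ring
  rw [key F, key G]
  have e1 : ∑ c ∈ univ \ {a, b}, (F a c + F b c + (F c a + F c b)) ≤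
      ∑ c ∈ univ \ {a, b}, (G a c + G b c + (G c a + G c b)) :=
    sum_le_sum fun c hc => by
      simp only [mem_sdiff, mem_univ, mem_insert, mem_singleton, true_and, not_or] at hc
      exact h1 c hc.1 hc.2
  have e2 : ∑ u ∈ univ \ {a, b}, ∑ v ∈ univ \ {a, b}, F u v ≤
      ∑ u ∈ univ \ {a, b}, ∑ v ∈ univ \ {a, b}, G u v :=
    sum_le_sum fun u hu => sum_le_sum fun v hv => by
      simp only [mem_sdiff, mem_univ, mem_insert, mem_singleton, true_and, not_or] at hu hv
      exact h0 u v hu.1 hu.2 hv.1 hv.2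
  omega

/-- For each third position, the inversions it forms with `a` and `b` do not become fewer, and the
pair `(a, b)` itself becomes an inversion. -/
theorem len_lt_mul_swap (y : Perm (Fin n)) {a b : Fin n} (hab : a < b) (hy : y a < y b) :
    len y < len (y * swap a b) := by
  have hsw : ∀ u, u ≠ a → u ≠ b → (y * swap a b) u = y u := fun u h1 h2 => by
    simp [swap_apply_of_ne_of_ne h1 h2]
  have ha : (y * swap a b) a = y b := by simp
  have hb : (y * swap a b) b = y a := by simp
  rw [len_eq_sum, len_eq_sum]
  have h := double_sum_le hab.ne (fun u v => if u < v ∧ y v < y u then 1 else 0)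
    (fun u v => if u < v ∧ (y * swap a b) v < (y * swap a b) u then 1 else 0)
    (fun u v h1 h2 h3 h4 => by simp only [hsw u h1 h2, hsw v h3 h4]; exact le_rfl)
    (fun c h1 h2 => by
      simp only [ha, hb, hsw c h1 h2]
      have h3 : y c ≠ y a := y.injective.ne h1
      have h4 : y c ≠ y b := y.injective.ne h2
      simp only [Fin.lt_def, ne_eq, Fin.ext_iff] at *
      split_ifs <;> omega)
  simp only [ha, hb, lt_irrefl, false_and, if_false, hab, hy, hab.not_gt, hy.not_gt,
    true_and, if_true] at h
  omega

/-! ### Bruhat order as dominance of rank functions. -/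

/-- Dominance of rank functions. -/
def RankLE (x w : Perm (Fin n)) : Prop := ∀ i j, rank w i j ≤ rank x i j

theorem exists_swap_of_step {u t : Perm (Fin n)} (ht : t.IsSwap) (hlen : len u < len (u * t)) :
    ∃ a b, a < b ∧ u a < u b ∧ t = swap a b := by
  obtain ⟨a, b, hab, rfl⟩ := ht
  wlog h : a < b generalizing a b
  · rw [swap_comm] at hlen ⊢
    exact this b a hab.symm hlen (lt_of_le_of_ne (not_lt.1 h) hab.symm)
  refine ⟨a, b, h, ?_, rfl⟩
  by_contra hu
  have hlt : u b < u a := lt_of_le_of_ne (not_lt.1 hu) (u.injective.ne hab.symm)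
  have := len_lt_mul_swap (u * swap a b) h (by simpa using hlt)
  rw [mul_assoc, swap_mul_self, mul_one] at this
  omega

theorem rankLE_mul_swap (y : Perm (Fin n)) {a b : Fin n} (hab : a < b) (hy : y a < y b) :
    RankLE y (y * swap a b) := fun i j => by
  rw [rank_mul_swap y hab hy]; split_ifs <;> omega

theorem BruhatLE.rankLE {x w : Perm (Fin n)} (h : BruhatLE x w) : RankLE x w := by
  induction h with
  | refl => exact fun i j => le_rfl
  | tail _ hs ih =>
    obtain ⟨t, ht, rfl, hlen⟩ := hs
    obtain ⟨a, b, hab, hu, rfl⟩ := exists_swap_of_step ht hlen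
    exact fun i j => (rankLE_mul_swap _ hab hu i j).trans (ih i j)

theorem bruhatLE_mul_swap (y : Perm (Fin n)) {a b : Fin n} (hab : a < b) (hy : y a < y b) :
    BruhatLE y (y * swap a b) :=
  Relation.ReflTransGen.single ⟨_, ⟨a, b, hab.ne, rfl⟩, rfl, len_lt_mul_swap y hab hy⟩

/-- Take `a` to be the first position where x and w differ; dominance forces `x a < w a`. Take `b`
to be the first later position with `x a < x b ≤ w a`. Choosing the first one guarantees slack
wherever the swap lowers the rank. -/
theorem RankLE.exists_swap {x w : Perm (Fin n)} (h : RankLE x w) (hne : x ≠ w) :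
    ∃ a b, a < b ∧ x a < x b ∧ RankLE (x * swap a b) w := by
  obtain ⟨a, ha, hmin⟩ : ∃ a, x a ≠ w a ∧ ∀ u < a, x u = w u := by
    have hex : (univ.filter fun a => x a ≠ w a).Nonempty := by
      obtain ⟨a, ha⟩ := not_forall.1 (fun hh => hne (Equiv.ext hh))
      exact ⟨a, by simpa using ha⟩
    refine ⟨_, (mem_filter.1 (min'_mem _ hex)).2, fun u hu => ?_⟩
    by_contra hc
    exact absurd (min'_le _ u (mem_filter.2 ⟨mem_univ _, hc⟩)) (not_le.2 hu)
  have hsplit : ∀ (y : Perm (Fin n)) (j : ℕ), rank y (a + 1) j =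
      rank y a j + if (y a : ℕ) < j then 1 else 0 := by
    intro y j
    have hs : (∑ u : Fin n, if u = a then (if (y a : ℕ) < j then (1 : ℤ) else 0) else 0) =
        if (y a : ℕ) < j then 1 else 0 := by simp
    unfold rank
    rw [← hs, ← sum_add_distrib]
    refine sum_congr rfl fun u _ => ?_
    by_cases hua : u = a
    · subst hua; simp
    · have : (u : ℕ) ≠ a := fun hh => hua (Fin.ext hh)
      simp only [hua, if_false, add_zero]
      refine if_congr (by constructor <;> rintro ⟨h1, h2⟩ <;> exact ⟨by omega, h2⟩) rfl rfl
  have hsame : ∀ j, rank x a j = rank w a j := fun j => by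
    unfold rank
    refine sum_congr rfl fun u _ => ?_
    by_cases hu : (u : ℕ) < a
    · rw [hmin u hu]
    · simp [hu]
  have hlt : (x a : ℕ) < w a := by
    have h1 := h (a + 1) (w a + 1)
    rw [hsplit, hsplit, hsame] at h1
    have h2 : (x a : ℕ) ≠ w a := fun hh => ha (Fin.ext hh)
    by_contra hc
    rw [if_pos (by omega), if_neg (by omega)] at h1
    omega
  obtain ⟨b, ⟨hab, hxb, hbw⟩, hbmin⟩ : ∃ b, (a < b ∧ x a < x b ∧ x b ≤ w a) ∧
      ∀ u < b, ¬ (a < u ∧ x a < x u ∧ x u ≤ w a) := by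
    have hex : (univ.filter fun b => a < b ∧ x a < x b ∧ x b ≤ w a).Nonempty := by
      refine ⟨x.symm (w a), mem_filter.2 ⟨mem_univ _, ?_, by simpa using hlt, by simp⟩⟩
      by_contra hc
      rcases lt_or_eq_of_le (not_lt.1 hc) with h1 | h1
      · have := hmin _ h1
        rw [apply_symm_apply] at this
        exact h1.ne (w.injective this).symm
      · rw [← h1, apply_symm_apply] at hlt
        rw [h1] at hlt
        omega
    refine ⟨_, (mem_filter.1 (min'_mem _ hex)).2, fun u hu hc => ?_⟩
    exact absurd (min'_le _ u (mem_filter.2 ⟨mem_univ _, hc⟩)) (not_le.2 hu)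
  refine ⟨a, b, hab, hxb, fun i j => ?_⟩
  rw [rank_mul_swap x hab hxb]
  split_ifs with hR
  · obtain ⟨h1, h2, h3, h4⟩ := hR
    have hbw' : (x b : ℕ) ≤ w a := hbw
    have key := h i (w a + 1)
    have cx := rank_box x (s := 0) (i := i) (t := j) (j := w a + 1) (by omega) (by omega)
    have cw := rank_box w (s := 0) (i := i) (t := j) (j := w a + 1) (by omega) (by omega)
    simp only [rank_zero_left] at cx cw
    -- Among positions before `i`, x takes fewer values in `[j, w a]` than w does: they agree before
    -- `a`, only w counts `a`, and by minimality of `b` x counts nothing after `a`. Dominance at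
    -- `(i, w a + 1)` then gives strict inequality at `(i, j)`.
    have hlt' : (∑ u : Fin n, if 0 ≤ (u : ℕ) ∧ (u : ℕ) < i ∧ j ≤ x u ∧ (x u : ℕ) < w a + 1
        then (1 : ℤ) else 0) < ∑ u : Fin n, if 0 ≤ (u : ℕ) ∧ (u : ℕ) < i ∧ j ≤ w u ∧
          (w u : ℕ) < w a + 1 then (1 : ℤ) else 0 := by
      refine sum_lt_sum (fun u _ => ?_) ⟨a, mem_univ _, ?_⟩
      · by_cases hc : 0 ≤ (u : ℕ) ∧ (u : ℕ) < i ∧ j ≤ x u ∧ (x u : ℕ) < w a + 1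
        · obtain ⟨c1, c2, c3, c4⟩ := hc
          rcases lt_trichotomy u a with hu | hu | hu
          · rw [hmin u hu]
          · subst hu; omega
          · exact absurd ⟨hu, by rw [Fin.lt_def]; omega, by rw [Fin.le_def]; omega⟩
              (hbmin u (by rw [Fin.lt_def]; omega))
        · rw [if_neg hc]; split_ifs <;> simp
      · rw [if_neg (by omega), if_pos (by omega)]; norm_num
    omega
  · simpa using h i j

theorem RankLE.bruhatLE {x w : Perm (Fin n)} (h : RankLE x w) : BruhatLE x w := by
  by_cases hne : x = w
  · exact hne ▸ Relation.ReflTransGen.refl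
  obtain ⟨a, b, hab, hx, h'⟩ := h.exists_swap hne
  have hdec := len_lt_mul_swap x hab hx
  have hb : len (x * swap a b) ≤ n * n := by
    rw [len]
    exact (card_filter_le _ _).trans (by simp)
  exact (bruhatLE_mul_swap x hab hx).trans h'.bruhatLE
termination_by n * n - len x
decreasing_by omega

/-! ### Counting ascent pairs: Deodhar's inequality. -/

/-- The rectangle of lattice points `(i, j)` with `a < i ≤ b` and `c < j ≤ d` meets `A`. -/
def Meets (A : ℕ → ℕ → Prop) (a b c d : ℕ) : Prop :=
  ∃ i j, a < i ∧ i ≤ b ∧ c < j ∧ j ≤ d ∧ A i j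

theorem Meets.mono {A A' : ℕ → ℕ → Prop} (hA : ∀ i j, A i j → A' i j) {a b c d : ℕ}
    (h : Meets A a b c d) : Meets A' a b c d := by
  obtain ⟨i, j, h1, h2, h3, h4, h5⟩ := h
  exact ⟨i, j, h1, h2, h3, h4, hA i j h5⟩

open Classical in
/-- The indicator of the event that `(u, v)` is an ascent pair of `y` whose rectangle meets `A`. -/
noncomputable def hitInd (A : ℕ → ℕ → Prop) (y : Perm (Fin n)) (u v : Fin n) : ℕ :=
  if u < v ∧ y u < y v ∧ Meets A u v (y u) (y v) then 1 else 0

/-- The number of ascent pairs of `y` whose rectangle meets `A`. -/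
noncomputable def hit (A : ℕ → ℕ → Prop) (y : Perm (Fin n)) : ℕ := ∑ u, ∑ v, hitInd A y u v

theorem hitInd_zero {A : ℕ → ℕ → Prop} {y : Perm (Fin n)} {u v : Fin n}
    (h : ¬ (u < v ∧ y u < y v ∧ Meets A u v (y u) (y v))) : hitInd A y u v = 0 := if_neg h

theorem hitInd_one {A : ℕ → ℕ → Prop} {y : Perm (Fin n)} {u v : Fin n}
    (h : u < v ∧ y u < y v ∧ Meets A u v (y u) (y v)) : hitInd A y u v = 1 := if_pos h

theorem hitInd_le_one (A : ℕ → ℕ → Prop) (y : Perm (Fin n)) (u v : Fin n) :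
    hitInd A y u v ≤ 1 := by unfold hitInd; split_ifs <;> simp

/-- Deodhar's inequality, relative to a set `A` of lattice points. -/
theorem hit_le_hit_mul_swap (A : ℕ → ℕ → Prop) (y : Perm (Fin n)) {a b : Fin n} (hab : a < b)
    (hy : y a < y b) (hA : ¬ Meets A a b (y a) (y b)) : hit A y ≤ hit A (y * swap a b) := by
  have hsw : ∀ u, u ≠ a → u ≠ b → (y * swap a b) u = y u := fun u h1 h2 => by
    simp [swap_apply_of_ne_of_ne h1 h2]
  have ha : (y * swap a b) a = y b := by simp
  have hb : (y * swap a b) b = y a := by simp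
  have h := double_sum_le hab.ne (hitInd A y) (hitInd A (y * swap a b))
    (fun u v h1 h2 h3 h4 => by unfold hitInd; rw [hsw u h1 h2, hsw v h3 h4])
    (fun c hca hcb => by
      have h3 : y c ≠ y a := y.injective.ne hca
      have h4 : y c ≠ y b := y.injective.ne hcb
      -- A point of `A` in an old rectangle at `c` avoids the rectangle of `(a, b)`, and this places
      -- it in a new rectangle at `c`. When both old pairs count, the smaller rectangle meets `A`
      -- and lies in both new ones.
      have hM : ∀ i j, (a : ℕ) < i → i ≤ b → (y a : ℕ) < j → j ≤ y b → ¬ A i j :=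
        fun i j h1 h2 h3 h4 h5 => hA ⟨i, j, h1, h2, h3, h4, h5⟩
      have hc := hsw c hca hcb
      have L1 := hitInd_le_one A y a c
      have L2 := hitInd_le_one A y b c
      have L3 := hitInd_le_one A y c a
      have L4 := hitInd_le_one A y c b
      have Z : ∀ {z : Perm (Fin n)} {u v : Fin n}, (u < v → z u < z v → False) →
        hitInd A z u v = 0 := fun h => hitInd_zero fun h' => h h'.1 h'.2.1
      have hab' : (a : ℕ) < b := hab
      have hy' : (y a : ℕ) < y b := hy
      rcases lt_or_gt_of_ne hca with h5 | h5
      · -- `c` to the left of `a`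
        have h5' : (c : ℕ) < a := h5
        have h6 : c < b := h5.trans hab
        rw [Z (u := a) (v := c) fun h _ => absurd h h5.not_gt,
          Z (u := b) (v := c) fun h _ => absurd h h6.not_gt]
        rcases lt_or_gt_of_ne h3 with h7 | h7
        · have h7' : (y c : ℕ) < y a := h7
          by_cases m1 : Meets A c a (y c) (y a)
          · have g1 : hitInd A (y * swap a b) c a = 1 := by
              refine hitInd_one ⟨h5, by rw [ha, hc]; exact h7.trans hy, ?_⟩
              obtain ⟨i, j, k1, k2, k3, k4, k5⟩ := m1
              exact ⟨i, j, k1, k2, by rw [hc]; exact k3, by rw [ha]; omega, k5⟩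
            have g2 : hitInd A (y * swap a b) c b = 1 := by
              refine hitInd_one ⟨h6, by rw [hb, hc]; exact h7, ?_⟩
              obtain ⟨i, j, k1, k2, k3, k4, k5⟩ := m1
              exact ⟨i, j, k1, by omega, by rw [hc]; exact k3, by rw [hb]; exact k4, k5⟩
            omega
          · rw [hitInd_zero (u := c) (v := a) fun h => m1 h.2.2]
            by_cases m2 : Meets A c b (y c) (y b)
            · obtain ⟨i, j, k1, k2, k3, k4, k5⟩ := m2
              by_cases hi : i ≤ a
              · have g1 : hitInd A (y * swap a b) c a = 1 :=
                  hitInd_one ⟨h5, by rw [ha, hc]; exact h7.trans hy,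
                    ⟨i, j, k1, hi, by rw [hc]; exact k3, by rw [ha]; exact k4, k5⟩⟩
                omega
              · have hj : j ≤ y a := by
                  by_contra hj
                  exact hM i j (by omega) k2 (by omega) k4 k5
                have g1 : hitInd A (y * swap a b) c b = 1 :=
                  hitInd_one ⟨h6, by rw [hb, hc]; exact h7,
                    ⟨i, j, k1, k2, by rw [hc]; exact k3, by rw [hb]; exact hj, k5⟩⟩
                omega
            · rw [hitInd_zero (u := c) (v := b) fun h => m2 h.2.2]
              omega
        · have h7' : (y a : ℕ) < y c := h7
          rw [Z (u := c) (v := a) fun _ h => absurd h h7.not_gt]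
          by_cases m2 : c < b ∧ y c < y b ∧ Meets A c b (y c) (y b)
          · obtain ⟨-, k0, i, j, k1, k2, k3, k4, k5⟩ := m2
            have hi : i ≤ a := by
              by_contra hi
              exact hM i j (by omega) k2 (by omega) k4 k5
            have g1 : hitInd A (y * swap a b) c a = 1 :=
              hitInd_one ⟨h5, by rw [ha, hc]; exact k0,
                ⟨i, j, k1, hi, by rw [hc]; exact k3, by rw [ha]; exact k4, k5⟩⟩
            omega
          · rw [hitInd_zero m2]; omega
      · have h5' : (a : ℕ) < c := h5
        rw [Z (u := c) (v := a) fun h _ => absurd h h5.not_gt]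
        rcases lt_or_gt_of_ne hcb with h6 | h6
        · -- `c` between `a` and `b`
          have h6' : (c : ℕ) < b := h6
          rw [Z (u := b) (v := c) fun h _ => absurd h h6.not_gt]
          rcases lt_or_gt_of_ne h3 with h7 | h7
          · have h7' : (y c : ℕ) < y a := h7
            rw [Z (u := a) (v := c) fun _ h => absurd h h7.not_gt]
            by_cases m2 : c < b ∧ y c < y b ∧ Meets A c b (y c) (y b)
            · obtain ⟨-, k0, i, j, k1, k2, k3, k4, k5⟩ := m2
              have hj : j ≤ y a := by
                by_contra hj
                exact hM i j (by omega) k2 (by omega) k4 k5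
              have g1 : hitInd A (y * swap a b) c b = 1 :=
                hitInd_one ⟨h6, by rw [hb, hc]; exact h7,
                  ⟨i, j, k1, k2, by rw [hc]; exact k3, by rw [hb]; exact hj, k5⟩⟩
              omega
            · rw [hitInd_zero m2]; omega
          · have h7' : (y a : ℕ) < y c := h7
            rcases lt_or_gt_of_ne h4 with h8 | h8
            · have h8' : (y c : ℕ) < y b := h8
              rw [hitInd_zero (y := y) (u := a) (v := c) fun ⟨_, _, i, j, k1, k2, k3, k4, k5⟩ =>
                  hM i j k1 (by omega) k3 (by omega) k5,
                hitInd_zero (y := y) (u := c) (v := b) fun ⟨_, _, i, j, k1, k2, k3, k4, k5⟩ =>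
                  hM i j (by omega) k2 (by omega) k4 k5]
              omega
            · have h8' : (y b : ℕ) < y c := h8
              rw [Z (u := c) (v := b) fun _ h => absurd h h8.not_gt]
              by_cases m2 : a < c ∧ y a < y c ∧ Meets A a c (y a) (y c)
              · obtain ⟨-, k0, i, j, k1, k2, k3, k4, k5⟩ := m2
                have hj : y b < j := by
                  by_contra hj
                  exact hM i j k1 (by omega) k3 (by omega) k5
                have g1 : hitInd A (y * swap a b) a c = 1 :=
                  hitInd_one ⟨h5, by rw [ha, hc]; exact h8,
                    ⟨i, j, k1, k2, by rw [ha]; exact hj, by rw [hc]; exact k4, k5⟩⟩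
                omega
              · rw [hitInd_zero m2]; omega
        · -- `c` to the right of `b`
          have h6' : (b : ℕ) < c := h6
          rw [Z (u := c) (v := b) fun h _ => absurd h h6.not_gt]
          rcases lt_or_gt_of_ne h4 with h8 | h8
          · have h8' : (y c : ℕ) < y b := h8
            rw [Z (u := b) (v := c) fun _ h => absurd h h8.not_gt]
            by_cases m2 : a < c ∧ y a < y c ∧ Meets A a c (y a) (y c)
            · obtain ⟨-, k0, i, j, k1, k2, k3, k4, k5⟩ := m2
              have hi : b < i := by
                by_contra hi
                exact hM i j k1 (by omega) k3 (by omega) k5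
              have g1 : hitInd A (y * swap a b) b c = 1 :=
                hitInd_one ⟨h6, by rw [hb, hc]; exact k0,
                  ⟨i, j, hi, k2, by rw [hb]; exact k3, by rw [hc]; exact k4, k5⟩⟩
              omega
            · rw [hitInd_zero m2]; omega
          · have h8' : (y b : ℕ) < y c := h8
            by_cases m1 : Meets A b c (y b) (y c)
            · have g1 : hitInd A (y * swap a b) a c = 1 := by
                refine hitInd_one ⟨h5, by rw [ha, hc]; exact h8, ?_⟩
                obtain ⟨i, j, k1, k2, k3, k4, k5⟩ := m1
                exact ⟨i, j, by omega, k2, by rw [ha]; exact k3, by rw [hc]; exact k4, k5⟩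
              have g2 : hitInd A (y * swap a b) b c = 1 := by
                refine hitInd_one ⟨h6, by rw [hb, hc]; exact hy.trans h8, ?_⟩
                obtain ⟨i, j, k1, k2, k3, k4, k5⟩ := m1
                exact ⟨i, j, k1, k2, by rw [hb]; omega, by rw [hc]; exact k4, k5⟩
              omega
            · rw [hitInd_zero (u := b) (v := c) fun h => m1 h.2.2]
              by_cases m2 : Meets A a c (y a) (y c)
              · obtain ⟨i, j, k1, k2, k3, k4, k5⟩ := m2
                by_cases hi : i ≤ b
                · have hj : y b < j := by
                    by_contra hj
                    exact hM i j k1 hi k3 (by omega) k5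
                  have g1 : hitInd A (y * swap a b) a c = 1 :=
                    hitInd_one ⟨h5, by rw [ha, hc]; exact h8,
                      ⟨i, j, k1, k2, by rw [ha]; exact hj, by rw [hc]; exact k4, k5⟩⟩
                  omega
                · have g1 : hitInd A (y * swap a b) b c = 1 :=
                    hitInd_one ⟨h6, by rw [hb, hc]; exact hy.trans h8,
                      ⟨i, j, by omega, k2, by rw [hb]; exact k3, by rw [hc]; exact k4, k5⟩⟩
                  omega
              · rw [hitInd_zero (u := a) (v := c) fun h => m2 h.2.2]
                omega)
  have e1 : hitInd A y a b = 0 := hitInd_zero fun h => hA h.2.2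
  have e2 : hitInd A y a a = 0 := hitInd_zero fun h => lt_irrefl _ h.1
  have e3 : hitInd A y b b = 0 := hitInd_zero fun h => lt_irrefl _ h.1
  have e4 : hitInd A y b a = 0 := hitInd_zero fun h => absurd h.1 hab.not_gt
  unfold hit
  omega

/-- `hit A` is monotone along the Bruhat order as long as the rank function is constant on `A`. -/
theorem BruhatLE.hit_le {A : ℕ → ℕ → Prop} {y w : Perm (Fin n)} (h : BruhatLE y w)
    (hA : ∀ i j, A i j → rank y i j = rank w i j) : hit A y ≤ hit A w := by
  revert hA
  refine Relation.ReflTransGen.head_induction_on h (fun _ => le_rfl) ?_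
  rintro u v ⟨t, ht, rfl, hlen⟩ hv ih hA
  obtain ⟨a, b, hab, hu, rfl⟩ := exists_swap_of_step ht hlen
  have h1 := rankLE_mul_swap u hab hu
  have h2 := BruhatLE.rankLE hv
  refine (hit_le_hit_mul_swap A u hab hu ?_).trans
    (ih fun i j hij => le_antisymm ((h1 i j).trans (hA i j hij).le) (h2 i j))
  rintro ⟨i, j, k1, k2, k3, k4, k5⟩
  have h3 := rank_mul_swap u hab hu i j
  rw [if_pos ⟨k1, k2, k3, k4⟩] at h3
  have h4 := hA i j k5
  have h5 := h2 i j
  omega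

/-- If `A ⊆ A'` and as many ascent pairs of `y` meet `A` as meet `A'`, then those pairs agree. -/
theorem meets_of_hit_le {A A' : ℕ → ℕ → Prop} (hA : ∀ i j, A i j → A' i j) {y : Perm (Fin n)}
    (h : hit A' y ≤ hit A y) {a b : Fin n} (hab : a < b) (hy : y a < y b)
    (hm : Meets A' a b (y a) (y b)) : Meets A a b (y a) (y b) := by
  by_contra hc
  have hle : ∀ u v, hitInd A y u v ≤ hitInd A' y u v := fun u v => by
    by_cases h : u < v ∧ y u < y v ∧ Meets A u v (y u) (y v)
    · rw [hitInd_one h, hitInd_one ⟨h.1, h.2.1, h.2.2.mono hA⟩]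
    · rw [hitInd_zero h]; exact Nat.zero_le _
  have : hit A y < hit A' y := by
    refine sum_lt_sum (fun u _ => sum_le_sum fun v _ => hle u v) ⟨a, mem_univ _, ?_⟩
    refine sum_lt_sum (fun v _ => hle a v) ⟨b, mem_univ _, ?_⟩
    rw [hitInd_zero fun h => hc h.2.2, hitInd_one ⟨hab, hy, hm⟩]
    exact Nat.zero_lt_one
  omega

open Classical in
/-- Every pair of positions is an inversion, or an ascent pair meeting `A`, or one missing `A`. -/
theorem len_add_hit_add_card (A : ℕ → ℕ → Prop) (y : Perm (Fin n)) :
    len y + hit A y + (univ.filter fun p : Fin n × Fin n =>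
      p.1 < p.2 ∧ y p.1 < y p.2 ∧ ¬ Meets A p.1 p.2 (y p.1) (y p.2)).card =
      ∑ u : Fin n, ∑ v : Fin n, if u < v then 1 else 0 := by
  rw [len_eq_sum, hit, card_filter, ← univ_product_univ, sum_product, ← sum_add_distrib,
    ← sum_add_distrib]
  refine sum_congr rfl fun u _ => ?_
  rw [← sum_add_distrib, ← sum_add_distrib]
  refine sum_congr rfl fun v _ => ?_
  unfold hitInd
  by_cases huv : u < v
  · have : y u ≠ y v := y.injective.ne huv.ne
    rcases lt_or_gt_of_ne this with h | h
    · by_cases hm : Meets A u v (y u) (y v) <;> simp [huv, h, h.not_gt, hm]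
    · simp [huv, h, h.not_gt]
  · simp [huv]

theorem swap_injOn {a b a' b' : Fin n} (h : a < b) (h' : a' < b') (he : swap a b = swap a' b') :
    a = a' ∧ b = b' := by
  have h1 : swap a' b' a = b := by rw [← he, swap_apply_left]
  by_cases e1 : a = a'
  · subst e1
    rw [swap_apply_left] at h1
    exact ⟨rfl, h1.symm⟩
  · by_cases e2 : a = b'
    · subst e2
      rw [swap_apply_right] at h1
      subst h1
      exact absurd h h'.not_gt
    · rw [swap_apply_of_ne_of_ne e1 e2] at h1
      exact absurd h1 h.ne

/-! ### The consequence of smoothness. -/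

/-- For a smooth pair `(w, x)` and `y` between `x` and `w`, the rectangle of every ascent pair of
`y` on which the rank functions of `y` and `w` agree somewhere contains a point at which those of
`x` and `w` agree. -/
theorem IsSmoothPair.meets {w x y : Perm (Fin n)} (h : IsSmoothPair w x) (hxy : RankLE x y)
    (hyw : RankLE y w) {a b : Fin n} (hab : a < b) (hy : y a < y b)
    (hm : Meets (fun i j => rank y i j = rank w i j) a b (y a) (y b)) :
    Meets (fun i j => rank x i j = rank w i j) a b (y a) (y b) := by
  classical
  have hsub : ∀ i j, rank x i j = rank w i j → rank y i j = rank w i j := fun i j hij =>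
    le_antisymm ((hxy i j).trans hij.le) (hyw i j)
  refine meets_of_hit_le hsub ?_ hab hy hm
  have hxw := h.1.rankLE
  have e1 : hit (fun i j => rank y i j = rank w i j) y ≤ hit _ w :=
    hyw.bruhatLE.hit_le fun i j hij => hij
  have e2 : hit (fun i j => rank x i j = rank w i j) x ≤ hit _ y :=
    hxy.bruhatLE.hit_le fun i j hij => hij.trans (hsub i j hij).symm
  have e3 := len_add_hit_add_card (fun i j => rank y i j = rank w i j) w
  have e4 := len_add_hit_add_card (fun i j => rank x i j = rank w i j) x
  set S := univ.filter fun p : Fin n × Fin n => p.1 < p.2 ∧ x p.1 < x p.2 ∧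
    ¬ Meets (fun i j => rank x i j = rank w i j) p.1 p.2 (x p.1) (x p.2) with hS
  -- Swapping a pair in `S` lowers the rank of x by one only where it strictly exceeds that of w, so
  -- the result stays below w. With `e3`, `e4` and smoothness this gives `hit` of w at most `hit` of
  -- x, which closes the chain from `e1` to `e2`.
  have e5 : S.card ≤ (reflections w x).ncard := by
    rw [← Set.ncard_coe_finset]
    refine Set.ncard_le_ncard_of_injOn (fun p => swap p.1 p.2) ?_ ?_ (Set.toFinite _)
    · intro p hp
      obtain ⟨-, h1, h2, h3⟩ := mem_filter.1 (mem_coe.1 hp)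
      refine ⟨⟨p.1, p.2, h1.ne, rfl⟩, ⟨bruhatLE_mul_swap x h1 h2, fun he => ?_⟩, ?_⟩
      · have := congrArg (fun z : Perm (Fin n) => z p.1) he
        simp only [Perm.mul_apply, swap_apply_left] at this
        exact h2.ne this
      · refine RankLE.bruhatLE fun i j => ?_
        rw [rank_mul_swap x h1 h2]
        have h4 := hxw i j
        split_ifs with hc
        · have : rank x i j ≠ rank w i j := fun he =>
            h3 ⟨i, j, hc.1, hc.2.1, hc.2.2.1, hc.2.2.2, he⟩
          omega
        · simpa using h4
    · intro p hp q hq he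
      obtain ⟨-, h1, -⟩ := mem_filter.1 (mem_coe.1 hp)
      obtain ⟨-, h2, -⟩ := mem_filter.1 (mem_coe.1 hq)
      exact Prod.ext_iff.2 (swap_injOn h1 h2 he)
  have e6 := h.2
  omega

theorem lt_of_rank_lt {w x : Perm (Fin n)} {s t : ℕ} (h : rank w s t < rank x s t) :
    0 < s ∧ 0 < t ∧ s ≠ n ∧ t ≠ n := by
  refine ⟨Nat.pos_of_ne_zero ?_, Nat.pos_of_ne_zero ?_, ?_, ?_⟩
  · rintro rfl; simp [rank_zero_left] at h
  · rintro rfl; simp [rank_zero_right] at h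
  · rintro rfl; simp [rank_full_left] at h
  · rintro rfl; simp [rank_full_right] at h

/-! ### Permutations between x and w through a prescribed cell. -/

/-- If `x` strictly dominates `w` at all lattice points to the south-west of the cell `(a, c)`
visible from it, then some permutation between `x` and `w` passes through that cell, and its rank
function only differs from that of `w` to the south-west. -/
theorem exists_southwest_star {x : Perm (Fin n)} (a c : Fin n) (w : Perm (Fin n))
    (hxw : RankLE x w)
    (hM : ∀ s t : ℕ, s ≤ a → t ≤ c → Free w s (a + 1) t (c + 1) → rank w s t < rank x s t) :
    ∃ y, RankLE x y ∧ RankLE y w ∧ y a = c ∧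
      ∀ s t : ℕ, ((a : ℕ) < s ∨ (c : ℕ) < t) → rank y s t = rank w s t := by
  have h1 : w a ≤ c := by
    by_contra hc
    rw [Fin.le_def] at hc
    -- Ranks vanish at `(a, 0)`, so a strict inequality there is impossible. If `w a` exceeded `c`,
    -- this point would be visible.
    have := lt_of_rank_lt (hM a 0 le_rfl (by omega) fun u u1 u2 _ u4 => by
      have : u = a := Fin.ext (by omega)
      subst this; omega)
    omega
  rcases eq_or_lt_of_le h1 with h1 | h1
  · exact ⟨w, hxw, fun _ _ => le_rfl, h1, fun _ _ _ => rfl⟩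
  obtain ⟨b, ⟨hba, hab', hbc⟩, hbmax⟩ : ∃ b, (b < a ∧ w a < w b ∧ w b ≤ c) ∧
      ∀ u, b < u → ¬ (u < a ∧ w a < w u ∧ w u ≤ c) := by
    have hex : (univ.filter fun b => b < a ∧ w a < w b ∧ w b ≤ c).Nonempty := by
      refine ⟨w.symm c, mem_filter.2 ⟨mem_univ _, ?_, by simpa using h1, by simp⟩⟩
      by_contra hc
      have := lt_of_rank_lt (hM 0 c (by omega) le_rfl fun u _ u2 u3 u4 => by
        have e : u = w.symm c := by
          rw [Equiv.eq_symm_apply]; exact Fin.ext (by omega)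
        have e' : u = a := by
          subst e; rw [Fin.lt_def] at hc; exact Fin.ext (by omega)
        rw [e'] at u3
        rw [Fin.lt_def] at h1
        omega)
      omega
    refine ⟨_, (mem_filter.1 (max'_mem _ hex)).2, fun u hu hc => ?_⟩
    exact absurd (le_max' _ u (mem_filter.2 ⟨mem_univ _, hc⟩)) (not_le.2 hu)
  set w' := w * swap b a with hw'
  have ea : w' a = w b := by simp [hw']
  have eb : w' b = w a := by simp [hw']
  have eo : ∀ u, u ≠ a → u ≠ b → w' u = w u := fun u k1 k2 => by
    simp [hw', swap_apply_of_ne_of_ne k2 k1]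
  have ew : w' * swap b a = w := by simp [hw', mul_assoc]
  have hasc : w' b < w' a := by rwa [ea, eb]
  have hr := rank_mul_swap w' hba hasc
  rw [ew, ea, eb] at hr
  rw [Fin.lt_def] at hba hab' h1
  rw [Fin.le_def] at hbc
  -- Maximality of `b` makes every point where `w'` has larger rank than w visible from the cell in
  -- w, so the slack in `hM` keeps `w'` above x. Conversely, a point visible in `w'` must lie beyond
  -- the value `w b`, so it is visible in w with unchanged rank.
  obtain ⟨y, k1, k2, k3, k4⟩ := exists_southwest_star (x := x) a c w' (fun i j => by
      have h2 := hr i j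
      have h3 := hxw i j
      split_ifs at h2 with hc
      · obtain ⟨c1, c2, c3, c4⟩ := hc
        have := hM i j (by omega) (by omega) fun u u1 u2 u3 u4 => by
          rcases eq_or_ne u a with rfl | hu
          · omega
          · have : (u : ℕ) ≠ a := fun hh => hu (Fin.ext hh)
            exact hbmax u (by rw [Fin.lt_def]; omega)
              ⟨by rw [Fin.lt_def]; omega, by rw [Fin.lt_def]; omega, by rw [Fin.le_def]; omega⟩
        omega
      · omega)
    (fun s t hs ht hf => by
      have htb : (w b : ℕ) < t := by
        by_contra hc
        exact hf a hs (by omega) (by rw [ea]; omega) (by rw [ea]; omega)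
      have h2 := hr s t
      rw [if_neg (by omega)] at h2
      have := hM s t hs ht fun u u1 u2 u3 u4 => by
        rcases eq_or_ne u a with rfl | hu
        · omega
        rcases eq_or_ne u b with rfl | hu'
        · omega
        exact hf u u1 u2 (by rw [eo u hu hu']; exact u3) (by rw [eo u hu hu']; exact u4)
      omega)
  refine ⟨y, k1, fun i j => ?_, k3, fun s t hst => ?_⟩
  · have := k2 i j
    have h2 := hr i j
    split_ifs at h2 <;> omega
  · rw [k4 s t hst, hr, if_neg (by omega)]; ring
termination_by (c : ℕ) - w a
decreasing_by
  have e : (w * swap b a) a = w b := by simp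
  rw [e]
  omega

/-- The analogue of `exists_southwest_star` for the opposite direction. -/
theorem exists_northeast_star {x : Perm (Fin n)} (a c : Fin n) (w : Perm (Fin n))
    (hxw : RankLE x w)
    (hM : ∀ s t : ℕ, (a : ℕ) < s → s ≤ n → (c : ℕ) < t → t ≤ n → Free w a s c t →
      rank w s t < rank x s t) :
    ∃ y, RankLE x y ∧ RankLE y w ∧ y a = c ∧ (∀ u < a, y u = w u) ∧
      ∀ s t : ℕ, (s ≤ a ∨ t ≤ c) → rank y s t = rank w s t := by
  have ha := a.is_lt
  have hc := c.is_lt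
  have h1 : c ≤ w a := by
    by_contra hc
    rw [Fin.le_def] at hc
    -- Here the boundary value `n` plays the part that `0` has in the south-west case: all
    -- permutations have equal ranks there.
    have := lt_of_rank_lt (hM (a + 1) n (by omega) (by omega) (by omega) le_rfl
      fun u u1 u2 u3 _ => by
        have : u = a := Fin.ext (by omega)
        subst this; omega)
    omega
  rcases eq_or_lt_of_le h1 with h1 | h1
  · exact ⟨w, hxw, fun _ _ => le_rfl, h1.symm, fun _ _ => rfl, fun _ _ _ => rfl⟩
  obtain ⟨b, ⟨hba, hab', hbc⟩, hbmin⟩ : ∃ b, (a < b ∧ w b < w a ∧ c ≤ w b) ∧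
      ∀ u, u < b → ¬ (a < u ∧ w u < w a ∧ c ≤ w u) := by
    have hex : (univ.filter fun b => a < b ∧ w b < w a ∧ c ≤ w b).Nonempty := by
      refine ⟨w.symm c, mem_filter.2 ⟨mem_univ _, ?_, by simpa using h1, by simp⟩⟩
      by_contra hc
      have := lt_of_rank_lt (hM n (c + 1) (by omega) le_rfl (by omega) (by omega)
        fun u u1 _ u3 u4 => by
          have e : u = w.symm c := by
            rw [Equiv.eq_symm_apply]; exact Fin.ext (by omega)
          have e' : u = a := by
            subst e; rw [Fin.lt_def] at hc; exact Fin.ext (by omega)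
          rw [e'] at u4
          rw [Fin.lt_def] at h1
          omega)
      omega
    refine ⟨_, (mem_filter.1 (min'_mem _ hex)).2, fun u hu hc => ?_⟩
    exact absurd (min'_le _ u (mem_filter.2 ⟨mem_univ _, hc⟩)) (not_le.2 hu)
  set w' := w * swap a b with hw'
  have ea : w' a = w b := by simp [hw']
  have eb : w' b = w a := by simp [hw']
  have eo : ∀ u, u ≠ a → u ≠ b → w' u = w u := fun u k1 k2 => by
    simp [hw', swap_apply_of_ne_of_ne k1 k2]
  have ew : w' * swap a b = w := by simp [hw', mul_assoc]
  have hasc : w' a < w' b := by rwa [ea, eb]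
  have hr := rank_mul_swap w' hba hasc
  rw [ew, ea, eb] at hr
  have hbn := b.is_lt
  have hwn := (w a).is_lt
  rw [Fin.lt_def] at hba hab' h1
  rw [Fin.le_def] at hbc
  obtain ⟨y, k1, k2, k3, k5, k4⟩ := exists_northeast_star (x := x) a c w' (fun i j => by
      have h2 := hr i j
      have h3 := hxw i j
      split_ifs at h2 with hc
      · obtain ⟨c1, c2, c3, c4⟩ := hc
        have := hM i j (by omega) (by omega) (by omega) (by omega) fun u u1 u2 u3 u4 => by
          rcases eq_or_ne u a with rfl | hu
          · omega
          · have : (u : ℕ) ≠ a := fun hh => hu (Fin.ext hh)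
            exact hbmin u (by rw [Fin.lt_def]; omega)
              ⟨by rw [Fin.lt_def]; omega, by rw [Fin.lt_def]; omega, by rw [Fin.le_def]; omega⟩
        omega
      · omega)
    (fun s t hs hs' ht ht' hf => by
      have htb : t ≤ (w b : ℕ) := by
        by_contra hc
        exact hf a le_rfl hs (by rw [ea]; omega) (by rw [ea]; omega)
      have h2 := hr s t
      rw [if_neg (by omega)] at h2
      have := hM s t hs hs' ht ht' fun u u1 u2 u3 u4 => by
        rcases eq_or_ne u a with rfl | hu
        · omega
        rcases eq_or_ne u b with rfl | hu'
        · omega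
        exact hf u u1 u2 (by rw [eo u hu hu']; exact u3) (by rw [eo u hu hu']; exact u4)
      omega)
  refine ⟨y, k1, fun i j => ?_, k3, fun u hu => ?_, fun s t hst => ?_⟩
  · have := k2 i j
    have h2 := hr i j
    split_ifs at h2 <;> omega
  · rw [k5 u hu]
    rw [Fin.lt_def] at hu
    exact eo u (fun e => by subst e; omega) (fun e => by subst e; omega)
  · rw [k4 s t hst, hr, if_neg (by omega)]; ring
termination_by (w a : ℕ) - c
decreasing_by
  have e : (w * swap a b) a = w b := by simp
  rw [e]
  omega

/-! ### Extremal points outside the influence set. -/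

theorem rank_sub_add_of_free {w x : Perm (Fin n)} {s i t j : ℕ} (hs : s ≤ i) (ht : t ≤ j)
    (hw : Free w s i t j) (hx : Free x s i t j) :
    (rank x i j - rank w i j) + (rank x s t - rank w s t) =
      (rank x s j - rank w s j) + (rank x i t - rank w i t) := by
  have h1 := (free_iff w hs ht).1 hw
  have h2 := (free_iff x hs ht).1 hx
  omega

/-- A point can be moved horizontally to the left along a pair of zeros of the rank difference. -/
def HasLeft (w x : Perm (Fin n)) (i e : ℕ) : Prop :=
  ∃ d j, d < i ∧ j < e ∧ rank x d j = rank w d j ∧ rank x d e = rank w d e ∧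
    Free w d i j e ∧ Free x d i j e

/-- A point can be moved vertically downwards along a pair of zeros of the rank difference. -/
def HasDown (w x : Perm (Fin n)) (i j : ℕ) : Prop :=
  ∃ d l, d < i ∧ l < j ∧ rank x i l = rank w i l ∧ rank x d l = rank w d l ∧
    Free w d i l j ∧ Free x d i l j

/-- In a nonempty set `U` of lattice points whose complement is closed under the operation
defining influence sets, there are two points, one weakly south-west of the other, which span a
rectangle without zeros of the rank difference, such that no such zero is visible to the south-west
of the first or to the north-east of the second. -/
theorem exists_unblocked_pair {w x : Perm (Fin n)} (hxw : RankLE x w) (U : ℕ → ℕ → Prop)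
    (hn : ∀ i j, U i j → i ≤ n ∧ j ≤ n)
    (hpos : ∀ i j, U i j → rank w i j < rank x i j)
    (hSW : ∀ i j s t, U i j → s < i → t < j → rank x s t = rank w s t → Free w s i t j →
      U s j ∨ U i t)
    (hNE : ∀ i j s t, U i j → i < s → s ≤ n → j < t → t ≤ n → rank x s t = rank w s t →
      Free w i s j t → U s j ∨ U i t)
    (hne : ∃ i j, U i j) :
    ∃ i₀ j₀ i₁ j₁, U i₀ j₀ ∧ U i₁ j₁ ∧ i₀ ≤ i₁ ∧ j₀ ≤ j₁ ∧
      (∀ s t, i₀ ≤ s → s ≤ i₁ → j₀ ≤ t → t ≤ j₁ → rank w s t < rank x s t) ∧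
      (∀ s t, s < i₀ → t < j₀ → Free w s i₀ t j₀ → rank w s t < rank x s t) ∧
      (∀ s t, i₁ < s → s ≤ n → j₁ < t → t ≤ n → Free w i₁ s j₁ t →
        rank w s t < rank x s t) := by
  classical
  -- the lowest level of the rank difference on `U`
  obtain ⟨k, hk⟩ : ∃ k : ℕ, (∃ i j, U i j ∧ rank x i j - rank w i j = k) ∧
      ∀ i j, U i j → (k : ℤ) ≤ rank x i j - rank w i j := by
    have hex : ∃ k : ℕ, ∃ i j, U i j ∧ rank x i j - rank w i j = k := by
      obtain ⟨i, j, hij⟩ := hne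
      have := hpos i j hij
      exact ⟨(rank x i j - rank w i j).toNat, i, j, hij, by omega⟩
    refine ⟨Nat.find hex, Nat.find_spec hex, fun i j hij => ?_⟩
    have h1 := hpos i j hij
    have := Nat.find_min' hex (m := (rank x i j - rank w i j).toNat) ⟨i, j, hij, by omega⟩
    omega
  obtain ⟨hkex, hkmin⟩ := hk
  set V : ℕ → ℕ → Prop := fun i j => U i j ∧ rank x i j - rank w i j = k with hV
  have hkpos : 0 < k := by
    obtain ⟨i, j, h1, h2⟩ := hkex
    have := hpos i j h1
    omega
  have hnn : ∀ i j, 0 ≤ rank x i j - rank w i j := fun i j => sub_nonneg.2 (hxw i j)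
  -- a zero which is visible to the south-west gives rise to a move
  have hmoveSW : ∀ i j s t, V i j → s < i → t < j → rank x s t = rank w s t →
      Free w s i t j → HasLeft w x i j ∨ HasDown w x i j := by
    intro i j s t hij hs ht h0 hf
    have e1 := (free_iff w hs.le ht.le).1 hf
    have e2 := rank_box_nonneg x hs.le ht.le
    have h2 := hij.2
    have n1 := hnn s j
    have n2 := hnn i t
    -- The two side corners have D-values summing to at most `k`, and one of them lies in `U`, so
    -- has value at least `k`. Hence that corner has value exactly `k`, the other is a zero, and the
    -- box is empty for x too.
    rcases hSW i j s t hij.1 hs ht h0 hf with h | h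
    · have h3 := hkmin _ _ h
      exact Or.inr ⟨s, t, hs, ht, by omega, h0, hf, (free_iff x hs.le ht.le).2 (by omega)⟩
    · have h3 := hkmin _ _ h
      exact Or.inl ⟨s, t, hs, ht, h0, by omega, hf, (free_iff x hs.le ht.le).2 (by omega)⟩
  have hleft : ∀ i e d j, V i e → d < i → j < e → rank x d j = rank w d j →
      rank x d e = rank w d e → Free w d i j e → Free x d i j e → V i j := by
    intro i e d j hie hd hj h1 h2 hf hfx
    have e1 := rank_sub_add_of_free hd.le hj.le hf hfx
    have h3 := hie.2
    refine ⟨(hSW i e d j hie.1 hd hj h1 hf).resolve_left fun h => ?_, by omega⟩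
    exact absurd (hpos _ _ h) (by omega)
  have hdown : ∀ i j d l, V i j → d < i → l < j → rank x i l = rank w i l →
      rank x d l = rank w d l → Free w d i l j → Free x d i l j → V d j := by
    intro i j d l hij hd hl h1 h2 hf hfx
    have e1 := rank_sub_add_of_free hd.le hl.le hf hfx
    have h3 := hij.2
    refine ⟨(hSW i j d l hij.1 hd hl h2 hf).resolve_right fun h => ?_, by omega⟩
    exact absurd (hpos _ _ h) (by omega)
  -- along a left move, the rank difference does not decrease to the right
  have hseg : ∀ i e d j s c, d < i → j < e → rank x d j = rank w d j →
      Free w d i j e → Free x d i j e → d ≤ s → s ≤ i → j ≤ c → c ≤ e →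
      rank x s j - rank w s j ≤ rank x s c - rank w s c := by
    intro i e d j s c hd hj h1 hf hfx s1 s2 c1 c2
    have e1 := rank_sub_add_of_free s1 c1 (hf.mono le_rfl s2 le_rfl c2)
      (hfx.mono le_rfl s2 le_rfl c2)
    have := hnn d c
    omega
  -- the north-east end
  obtain ⟨i₁, j₁, h₁, hmax⟩ : ∃ i₁ j₁, V i₁ j₁ ∧ ∀ i j, V i j → i + j ≤ i₁ + j₁ := by
    have hex : ∃ m, ∃ i j, V i j ∧ 2 * n = i + j + m := by
      obtain ⟨i, j, hij⟩ := hkex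
      have := hn i j hij.1
      exact ⟨2 * n - (i + j), i, j, hij, by omega⟩
    obtain ⟨i, j, hij, hm⟩ := Nat.find_spec hex
    refine ⟨i, j, hij, fun i' j' h' => ?_⟩
    have h2 := hn i' j' h'.1
    have := Nat.find_min' hex (m := 2 * n - (i' + j')) ⟨i', j', h', by omega⟩
    omega
  have hvisNE : ∀ s t, i₁ < s → s ≤ n → j₁ < t → t ≤ n → Free w i₁ s j₁ t →
      rank w s t < rank x s t := by
    intro s t hs hs' ht ht' hf
    by_contra hc
    have h0 : rank x s t = rank w s t := le_antisymm (not_lt.1 hc) (hxw s t)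
    have e1 := (free_iff w hs.le ht.le).1 hf
    have e2 := rank_box_nonneg x hs.le ht.le
    have h2 := h₁.2
    have n1 := hnn s j₁
    have n2 := hnn i₁ t
    rcases hNE i₁ j₁ s t h₁.1 hs hs' ht ht' h0 hf with h | h
    · have h3 := hkmin _ _ h
      have := hmax s j₁ ⟨h, by omega⟩
      omega
    · have h3 := hkmin _ _ h
      have := hmax i₁ t ⟨h, by omega⟩
      omega
  -- move to the left as far as possible
  obtain ⟨j₀, hj, hV0, hcol, hnoleft⟩ : ∃ j₀, j₀ ≤ j₁ ∧ V i₁ j₀ ∧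
      -- This invariant reduces zero-freeness of the whole rectangle to its edge at `j₀`. Only that
      -- edge then has to be tracked while `i₀` is lowered.
      (∀ d, d ≤ i₁ → (∀ s, d ≤ s → s ≤ i₁ → rank w s j₀ < rank x s j₀) →
        ∀ s c, d ≤ s → s ≤ i₁ → j₀ ≤ c → c ≤ j₁ → rank w s c < rank x s c) ∧
      ¬ HasLeft w x i₁ j₀ := by
    have hex : ∃ j₀, j₀ ≤ j₁ ∧ V i₁ j₀ ∧
      (∀ d, d ≤ i₁ → (∀ s, d ≤ s → s ≤ i₁ → rank w s j₀ < rank x s j₀) →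
        ∀ s c, d ≤ s → s ≤ i₁ → j₀ ≤ c → c ≤ j₁ → rank w s c < rank x s c) :=
      ⟨j₁, le_rfl, h₁, fun d _ h s c h1 h2 h3 h4 => by
        obtain rfl : c = j₁ := by omega
        exact h s h1 h2⟩
    obtain ⟨h1, h2, h3⟩ := Nat.find_spec hex
    refine ⟨_, h1, h2, h3, ?_⟩
    rintro ⟨d, j, hd, hj, z1, z2, hf, hfx⟩
    refine Nat.find_min hex hj ⟨by omega, hleft _ _ _ _ h2 hd hj z1 z2 hf hfx, ?_⟩
    intro d' hd' hpos' s c s1 s2 c1 c2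
    have hdd : d < d' := by
      by_contra hc
      exact absurd (hpos' d (by omega) hd.le) (by omega)
    have hseg' : ∀ s c, d' ≤ s → s ≤ i₁ → j ≤ c → c ≤ Nat.find hex →
        rank w s c < rank x s c := fun s c s1 s2 c1 c2 => by
      have h4 := hseg i₁ _ d j s c hd hj z1 hf hfx (by omega) s2 c1 c2
      have h5 := hpos' s s1 s2
      omega
    by_cases hc : c ≤ Nat.find hex
    · exact hseg' s c s1 s2 c1 hc
    · exact h3 d' hd' (fun s s1 s2 => hseg' s _ s1 s2 hj.le le_rfl) s c s1 s2 (by omega) c2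
  -- then move down as far as possible
  obtain ⟨i₀, hi, hV1, hrow, hnoleft', hnodown⟩ : ∃ i₀, i₀ ≤ i₁ ∧ V i₀ j₀ ∧
      (∀ s, i₀ ≤ s → s ≤ i₁ → rank w s j₀ < rank x s j₀) ∧ ¬ HasLeft w x i₀ j₀ ∧
      ¬ HasDown w x i₀ j₀ := by
    have hex : ∃ i₀, i₀ ≤ i₁ ∧ V i₀ j₀ ∧
      (∀ s, i₀ ≤ s → s ≤ i₁ → rank w s j₀ < rank x s j₀) ∧ ¬ HasLeft w x i₀ j₀ :=
      ⟨i₁, le_rfl, hV0, fun s h1 h2 => by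
        obtain rfl : s = i₁ := by omega
        exact hpos _ _ hV0.1, hnoleft⟩
    obtain ⟨h1, h2, h3, h4⟩ := Nat.find_spec hex
    refine ⟨_, h1, h2, h3, h4, ?_⟩
    rintro ⟨d, l, hd, hl, z1, z2, hf, hfx⟩
    have hVd := hdown _ _ _ _ h2 hd hl z1 z2 hf hfx
    refine Nat.find_min hex hd ⟨by omega, hVd, ?_, ?_⟩
    · intro s s1 s2
      by_cases hc : s ≤ Nat.find hex
      · have e1 := rank_sub_add_of_free s1 hl.le (hf.mono le_rfl hc le_rfl le_rfl)
          (hfx.mono le_rfl hc le_rfl le_rfl)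
        have e2 := hnn s l
        have e3 := hVd.2
        omega
      · exact h3 s (by omega) s2
    · rintro ⟨d', j, hd', hj', y1, y2, hg, hgx⟩
      have hVj := hleft _ _ _ _ hVd hd' hj' y1 y2 hg hgx
      -- Otherwise `(d, l)`, a zero of D, would lie on the segment of the left move, where D is at
      -- least its positive value at `(d, j)`. With `l ≤ j` the two empty boxes glue to a left move
      -- from the previous point, where none exists; so moving down creates no new left move.
      have hlj : l ≤ j := by
        by_contra hc
        have e1 := hseg d j₀ d' j d l hd' hj' y1 hg hgx hd'.le le_rfl (by omega) hl.le
        have e2 := hVj.2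
        omega
      have hcomb : ∀ z : Perm (Fin n), Free z d' d j j₀ → Free z d (Nat.find hex) l j₀ →
          Free z d' (Nat.find hex) j j₀ := fun z f1 f2 u u1 u2 u3 u4 => by
        by_cases hu : (u : ℕ) < d
        · exact f1 u u1 hu u3 u4
        · exact f2 u (by omega) u2 (by omega) u4
      exact h4 ⟨d', j, by omega, hj', y1, y2, hcomb w hg hf, hcomb x hgx hfx⟩
  refine ⟨i₀, j₀, i₁, j₁, hV1.1, h₁.1, hi, hj, fun s t s1 s2 t1 t2 =>
    hcol i₀ hi hrow s t s1 s2 t1 t2, fun s t hs ht hf => ?_, hvisNE⟩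
  by_contra hc
  rcases hmoveSW i₀ j₀ s t hV1 hs ht (le_antisymm (not_lt.1 hc) (hxw s t)) hf with h | h
  · exact hnoleft' h
  · exact hnodown h

/-! ### Influence sets and the conclusion. -/

theorem inflStep_mono (w : Perm (Fin n)) (A : Set (FramedSquare n)) : Monotone (inflStep w A) :=
  monotone_nat_of_le_succ fun _ => Set.subset_union_left

theorem subset_influenceSet (w : Perm (Fin n)) (A : Set (FramedSquare n)) :
    A ⊆ influenceSet w A := fun _ hp => Set.mem_iUnion.2 ⟨0, hp⟩

theorem mem_influenceSet_of_corners {w : Perm (Fin n)} {A : Set (FramedSquare n)}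
    {p p' : FramedSquare n} (hp' : p' ∈ A) (hc : StrictCmp p p') (hd : diff w p p' = 0)
    (h1 : (p.1, p'.2) ∈ influenceSet w A) (h2 : (p'.1, p.2) ∈ influenceSet w A) :
    p ∈ influenceSet w A := by
  obtain ⟨k1, h1⟩ := Set.mem_iUnion.1 h1
  obtain ⟨k2, h2⟩ := Set.mem_iUnion.1 h2
  refine Set.mem_iUnion.2 ⟨max k1 k2 + 1, Or.inr ⟨p', hp', hc, hd, ?_⟩⟩
  rintro q (rfl | rfl)
  · exact inflStep_mono w A (le_max_left _ _) h1
  · exact inflStep_mono w A (le_max_right _ _) h2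

theorem diff_eq_rank (w : Perm (Fin n)) (p p' : FramedSquare n) :
    diff w p p' = rank w p.1 p.2 + rank w p'.1 p'.2 - (rank w p.1 p'.2 + rank w p'.1 p.2) := by
  simp only [diff, rk_eq_rank]

theorem mem_levelSet_iff (w x : Perm (Fin n)) (p : FramedSquare n) :
    p ∈ levelSet w x ↔ rank x p.1 p.2 = rank w p.1 p.2 := by
  simp only [levelSet, pairRk, Set.mem_ofPred_eq, rk_eq_rank, sub_eq_zero]

theorem IsSmoothPair.isInfluential {w x : Perm (Fin n)} (h : IsSmoothPair w x) :
    IsInfluential w x := by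
  have hxw := h.1.rankLE
  by_contra hinf
  obtain ⟨p, hp⟩ : ∃ p, p ∉ influenceSet w (levelSet w x) := by
    by_contra hc
    exact hinf (Set.eq_univ_of_forall fun p => not_not.1 fun hp => hc ⟨p, hp⟩)
  obtain ⟨i₀, j₀, i₁, j₁, h0, h1, hi, hj, hrect, hsw, hne⟩ := exists_unblocked_pair hxw
    (fun i j => ∃ (hi : i < n + 1) (hj : j < n + 1),
      ((⟨i, hi⟩, ⟨j, hj⟩) : FramedSquare n) ∉ influenceSet w (levelSet w x))
    (fun i j ⟨hi, hj, _⟩ => ⟨by omega, by omega⟩)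
    (fun i j ⟨hi, hj, hU⟩ => lt_of_le_of_ne (hxw i j) fun he =>
      hU (subset_influenceSet w _ ((mem_levelSet_iff w x _).2 he.symm)))
    (fun i j s t ⟨hi, hj, hU⟩ hs ht h0 hf => by
      by_contra hc
      simp only [not_or, not_exists, not_not] at hc
      refine hU (mem_influenceSet_of_corners (p' := (⟨s, by omega⟩, ⟨t, by omega⟩))
        ((mem_levelSet_iff w x _).2 h0) (Or.inr ⟨hs, ht⟩) ?_ (hc.2 _ _) (hc.1 _ _))
      have := (free_iff w hs.le ht.le).1 hf
      rw [diff_eq_rank]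
      simp only
      omega)
    (fun i j s t ⟨hi, hj, hU⟩ hs hs' ht ht' h0 hf => by
      by_contra hc
      simp only [not_or, not_exists, not_not] at hc
      refine hU (mem_influenceSet_of_corners (p' := (⟨s, by omega⟩, ⟨t, by omega⟩))
        ((mem_levelSet_iff w x _).2 h0) (Or.inl ⟨hs, ht⟩) ?_ (hc.2 _ _) (hc.1 _ _))
      have := (free_iff w hs.le ht.le).1 hf
      rw [diff_eq_rank]
      simp only
      omega)
    ⟨p.1, p.2, p.1.is_lt, p.2.is_lt, hp⟩
  obtain ⟨b1, b2, -, -⟩ := lt_of_rank_lt (hrect i₀ j₀ le_rfl hi le_rfl hj)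
  obtain ⟨-, -, b3, b4⟩ := lt_of_rank_lt (hrect i₁ j₁ hi le_rfl hj le_rfl)
  obtain ⟨b5, b6, -⟩ := h1
  -- The lower corner becomes `(i + 1, j + 1)`: the cell to its south-west has zero-based indices
  -- `(i, j)`, while the cell to the north-east of the upper corner has indices `(i₁, j₁)`. The
  -- ascent rectangle of these two cells is exactly the zero-free one.
  obtain ⟨i, rfl⟩ := Nat.exists_eq_add_of_le' b1
  obtain ⟨j, rfl⟩ := Nat.exists_eq_add_of_le' b2
  obtain ⟨y, y1, y2, y3, y4⟩ := exists_southwest_star (x := x) ⟨i, by omega⟩ ⟨j, by omega⟩ w hxw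
    (fun s t hs ht hf => hsw s t (Nat.lt_succ_of_le hs) (Nat.lt_succ_of_le ht) hf)
  obtain ⟨z, z1, z2, z3, z5, z4⟩ := exists_northeast_star (x := x) ⟨i₁, by omega⟩ ⟨j₁, by omega⟩ y y1
    (fun s t hs hs' ht ht' hf => by
      simp only at hs ht hf
      have hf' := (free_iff y hs.le ht.le).1 hf
      simp only at y4
      -- The first modification did not change ranks at first coordinate beyond `i`, so visibility
      -- to the north-east is the same for y as for w.
      rw [y4 _ _ (Or.inl (by omega)), y4 _ _ (Or.inl (by omega)), y4 _ _ (Or.inl (by omega)),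
        y4 _ _ (Or.inl (by omega))] at hf'
      rw [y4 _ _ (Or.inl (by omega))]
      exact hne s t hs hs' ht ht' ((free_iff w hs.le ht.le).2 hf'))
  have hzi : z ⟨i, by omega⟩ = ⟨j, by omega⟩ := by
    rw [z5 _ (by rw [Fin.lt_def]; simp only; omega), y3]
  have hm := h.meets (y := z) z1 (fun s t => (y2 s t).trans (z2 s t))
    (a := ⟨i, by omega⟩) (b := ⟨i₁, by omega⟩) (by rw [Fin.lt_def]; simp only; omega)
    (by rw [hzi, z3, Fin.lt_def]; simp only; omega)
    ⟨i + 1, j + 1, by simp, hi, by rw [hzi]; simp, by rw [z3]; exact hj, by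
      exact (z4 _ _ (Or.inl hi)).trans (y4 _ _ (Or.inl (by simp)))⟩
  obtain ⟨s, t, k1, k2, k3, k4, k5⟩ := hm
  rw [hzi] at k3
  rw [z3] at k4
  simp only at k1 k2 k3 k4
  exact absurd (hrect s t (by omega) k2 (by omega) k4) (by omega)

/-- An influential pair is tight. -/
theorem IsInfluential.isTight {w x : Perm (Fin n)} (h : IsInfluential w x) :
    IsTight w (levelSet w x) := by
  intro y hy
  -- At a new point, the box with `p'` is empty for w and has nonnegative count for y. Equality at
  -- `p'` and the inequality at the two corners therefore pass to `p`.
  have key : ∀ k, ∀ p ∈ inflStep w (levelSet w x) k, rank w p.1 p.2 ≤ rank y p.1 p.2 := by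
    have hA : ∀ p ∈ levelSet w x, rank y p.1 p.2 = rank w p.1 p.2 := fun p hp => by
      rw [← rk_eq_rank, ← rk_eq_rank, hy p hp]
    intro k
    induction k with
    | zero => exact fun p hp => (hA p hp).ge
    | succ k ih =>
      rintro p (hp | ⟨p', hp', hc, hd, hcor⟩)
      · exact ih p hp
      · have c1 := ih _ (hcor (Or.inl rfl))
        have c2 := ih _ (hcor (Or.inr rfl))
        have c3 := hA p' hp'
        rw [diff_eq_rank] at hd
        simp only at c1 c2
        rcases hc with ⟨l1, l2⟩ | ⟨l1, l2⟩
        · have := rank_box_nonneg y (Fin.lt_def.1 l1).le (Fin.lt_def.1 l2).le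
          omega
        · have := rank_box_nonneg y (Fin.lt_def.1 l1).le (Fin.lt_def.1 l2).le
          omega
  refine RankLE.bruhatLE fun i j => ?_
  -- `RankLE` ranges over all natural numbers, whereas the framed square stops at `n`.
  have hclamp : ∀ z : Perm (Fin n), rank z i j = rank z (min i n) (min j n) := fun z => by
    unfold rank
    refine sum_congr rfl fun u _ => ?_
    have h1 := u.is_lt
    have h2 := (z u).is_lt
    exact if_congr (by omega) rfl rfl
  rw [hclamp w, hclamp y]
  have hmem : ((⟨min i n, by omega⟩, ⟨min j n, by omega⟩) : FramedSquare n) ∈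
      influenceSet w (levelSet w x) := by
    rw [h]; trivial
  obtain ⟨k, hk⟩ := Set.mem_iUnion.1 hmem
  exact key k _ hk

end SchubertPairs

theorem theorem2p6 (n : ℕ) (w x : Equiv.Perm (Fin n))
    (hsmooth : SchubertPairs.IsSmoothPair w x) :
    SchubertPairs.IsInfluential w x ∧
      SchubertPairs.IsTight w (SchubertPairs.levelSet w x) :=
  ⟨hsmooth.isInfluential, hsmooth.isInfluential.isTight⟩
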